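/- Let $G=(V,E)$ be a finite simple triangle-free graph with an edge-weight function $w:E\to\mathbb{R}_{\ge 0}$, let $\Delta\ge 0$ be an integer such that every vertex of $G$ has degree at most $\Delta$, and let $M$ be a matching in $G$. For a set (or subgraph) $F$ of edges write $w(F)=\sum_{e\in F}w(e)$, let $w(G)=w(E)$, and let $\mathrm{mac}(G)$ denote the maximum weight of a cut of $G$, i.e. the maximum over all $A\subseteq V$ of the total weight of the edges of $G$ with exactly one end in $A$. Then $$\mathrm{mac}(G)\;\ge\;\frac{\Delta}{2\Delta-1}\,\bigl(w(G)-w(M)\bigr)+w(M).$$ -/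

import Mathlib

namespace MaxCut

variable {V : Type*} [Finite V]

/-- The total weight `w(S) = ∑ e ∈ S, w e` of a set `S` of edges. -/
noncomputable def weight (w : Sym2 V → ℝ) (S : Set (Sym2 V)) : ℝ :=
  ∑ e ∈ S.toFinite.toFinset, w e

/-- The weight of the cut `(A, V \ A)` of `G`, that is, of the bipartite subgraph formed by the
edges of `G` with one end in `A` and the other end outside `A`. -/
noncomputable def cutWeight (G : SimpleGraph V) (w : Sym2 V → ℝ) (A : Set V) : ℝ :=
  weight w (G.between A Aᶜ).edgeSet

/-- The maximum weight of a cut of the finite weighted graph `(G, w)`. -/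
noncomputable def mac (G : SimpleGraph V) (w : Sym2 V → ℝ) : ℝ :=
  ⨆ A : Set V, cutWeight G w A

/-- The supremum in the definition of `mac` is a maximum. -/
theorem isGreatest_mac (G : SimpleGraph V) (w : Sym2 V → ℝ) :
    IsGreatest (Set.range (cutWeight G w)) (mac G w) := by
  obtain ⟨A, hA⟩ := exists_eq_ciSup_of_finite (f := cutWeight G w)
  refine ⟨⟨A, hA⟩, ?_⟩
  rintro _ ⟨B, rfl⟩
  exact le_ciSup (Set.finite_range (cutWeight G w)).bddAbove B

end MaxCut

/-! Contract each edge of `M` to get a graph `H` on blocks of one or two vertices. For `Δ ≥ 2` it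
has maximum degree at most `2Δ - 2`, so by Vizing's theorem its edges split into `2Δ - 1` matchings.
Fix one of them: its components consist of at most two blocks, hence of at most four vertices of
`G`, and since `G` is triangle-free each induces a bipartite graph (`exists_bipartition`). Flipping
these bipartitions by independent fair coins gives a random cut that contains every edge inside a
component and any other edge with probability 1/2. Now average over the matchings too. Edges of `M`
are always cut; every other edge lies inside a component for at least one matching, so it is cut
with probability at least `(1 + (2Δ - 2)/2)/(2Δ - 1) = Δ/(2Δ - 1)`. Some cut attains the average
(`mac_ge_of_contraction`). Vizing's theorem is proved by adding one vertex at a time and balancing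
the missing colours by Kempe exchanges. A colour class is an involution: matched vertices are
swapped, unmatched ones are fixed. -/

namespace EdgeColoring

open Function

/-! ### Orbits of two involutions (Kempe chains) -/

variable {V ι : Type*}

/-- In a dihedral group the reflection `a` conjugates the rotation `a * b` to its inverse. -/
theorem zpow_mul_apply_of_fixed (a b : Equiv.Perm V) (ha : ∀ x, a (a x) = x)
    (hb : ∀ x, b (b x) = x) {x : V} (hx : a x = x) (n : ℤ) :
    a (((a * b) ^ n) x) = ((a * b) ^ (-n)) x := by
  have h1 : SemiconjBy a (a * b) (a * b)⁻¹ := by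
    ext z
    simp [ha, hb, Equiv.Perm.inv_def, Equiv.eq_symm_apply]
  have h2 := congrArg (fun p : Equiv.Perm V => p x) (h1.zpow_right n).eq
  rw [inv_zpow'] at h2
  simpa only [Equiv.Perm.mul_apply, hx] using h2

/-- An orbit of the dihedral group generated by two involutions contains at most two fixed points
of the first one. -/
theorem card_fixed_le_two [Fintype V] [DecidableEq V] (a b : Equiv.Perm V)
    (ha : ∀ x, a (a x) = x) (hb : ∀ x, b (b x) = x)
    (x : V) (hx : a x = x) (T : Finset V)
    (hT : ∀ y ∈ T, a y = y ∧ (a * b).SameCycle x y) : T.card ≤ 2 := by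
  have hdih := zpow_mul_apply_of_fixed a b ha hb hx
  -- If `r = a * b` and `y = r ^ n x` is fixed by `a`, then `r ^ n x = r ^ (-n) x`. So modulo the
  -- period, `n` is zero or half the period, which leaves two points.
  have key : ∀ y ∈ T, ∃ n : ℤ, ((a * b) ^ n) x = y ∧
      (minimalPeriod ((a * b) • · ) x : ℤ) ∣ 2 * n := by
    intro y hy
    obtain ⟨h1, n, rfl⟩ := hT y hy
    refine ⟨n, rfl, ?_⟩
    rw [← MulAction.zpow_smul_eq_iff_minimalPeriod_dvd]
    rw [hdih] at h1
    rw [two_mul, zpow_add, mul_smul]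
    change ((a * b) ^ n) (((a * b) ^ n) x) = x
    rw [← h1, ← Equiv.Perm.mul_apply, ← zpow_add]
    simp
  by_contra hcard
  push Not at hcard
  have hE : 1 < (T.erase x).card := by
    have := Finset.pred_card_le_card_erase (s := T) (a := x)
    omega
  obtain ⟨y, hy, z, hz, hyz⟩ := Finset.one_lt_card.mp hE
  rw [Finset.mem_erase] at hy hz
  obtain ⟨n, rfl, s, hs⟩ := key y hy.2
  obtain ⟨m, rfl, t, ht⟩ := key z hz.2
  set p : ℤ := (minimalPeriod ((a * b) • · ) x : ℤ) with hp
  have hper : ∀ k : ℤ, ((a * b) ^ k) x = x ↔ p ∣ k := fun k => by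
    rw [hp, ← MulAction.zpow_smul_eq_iff_minimalPeriod_dvd]; rfl
  have odd_of : ∀ n s : ℤ, ((a * b) ^ n) x ≠ x → 2 * n = p * s → Odd s := by
    intro n s h1 h2
    by_contra h3
    rw [Int.not_odd_iff_even] at h3
    obtain ⟨q, rfl⟩ := h3
    exact h1 ((hper n).2 ⟨q, by linarith⟩)
  obtain ⟨q, hq⟩ := (odd_of n s hy.1 hs).sub_odd (odd_of m t hz.1 ht)
  refine hyz ?_
  have : ((a * b) ^ (-m + n)) x = x := (hper _).2 ⟨q, by
    have : 2 * (-m + n) = p * (s - t) := by linarith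
    rw [hq] at this
    linarith⟩
  rw [zpow_add, zpow_neg, Equiv.Perm.mul_apply, Equiv.Perm.inv_eq_iff_eq] at this
  exact this

/-- If `X` consists of fixed points of the involution `a` and has more elements than `Y`, then some
set invariant under the involutions `a` and `b` meets `X` in more elements than `Y`, but in at
most two. -/
theorem exists_kempe_set [Fintype V] [DecidableEq V] (a b : V → V) (ha : Involutive a)
    (hb : Involutive b) (X Y : Finset V) (hX : ∀ x ∈ X, a x = x) (hlt : Y.card < X.card) :
    ∃ S : Finset V, (∀ x, a x ∈ S ↔ x ∈ S) ∧ (∀ x, b x ∈ S ↔ x ∈ S) ∧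
      (Y.filter (· ∈ S)).card < (X.filter (· ∈ S)).card ∧ (X.filter (· ∈ S)).card ≤ 2 := by
  classical
  set r : Equiv.Perm V := ha.toPerm * hb.toPerm with hr
  let q : V → Quotient (Equiv.Perm.SameCycle.setoid r) := Quotient.mk _
  have hq : ∀ x y, q x = q y ↔ r.SameCycle x y := fun x y => Quotient.eq
  -- The cycles of `r` partition `V`, so on one of them `X` outnumbers `Y`. That cycle contains a
  -- fixed point of `a`, so it is invariant under `a`, and under `b = a ∘ r` as well.
  obtain ⟨c, hc⟩ : ∃ c, (Y.filter (q · = c)).card < (X.filter (q · = c)).card := by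
    by_contra! h
    rw [Finset.card_eq_sum_card_fiberwise (f := q) (s := X) (t := Finset.univ) (by simp),
      Finset.card_eq_sum_card_fiberwise (f := q) (s := Y) (t := Finset.univ) (by simp)] at hlt
    exact absurd (Finset.sum_le_sum fun c _ => h c) (not_le.2 hlt)
  obtain ⟨x, hx⟩ := Finset.card_pos.1 (lt_of_le_of_lt (Nat.zero_le _) hc)
  obtain ⟨hxX, rfl⟩ := Finset.mem_filter.1 hx
  have hax : a x = x := hX x hxX
  have h1 : ∀ n : ℤ, a ((r ^ n) x) = (r ^ (-n)) x :=
    zpow_mul_apply_of_fixed ha.toPerm hb.toPerm ha hb hax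
  have h2 : ∀ y, r.SameCycle x y → r.SameCycle x (a y) := by
    rintro _ ⟨n, rfl⟩
    exact ⟨-n, (h1 n).symm⟩
  have h3 : ∀ y, r.SameCycle x y → r.SameCycle x (b y) := by
    intro y hy
    have : b y = a (r y) := by simp [hr, ha (b y)]
    rw [this]
    exact h2 _ (Equiv.Perm.sameCycle_apply_right.2 hy)
  refine ⟨Finset.univ.filter (q · = q x), fun y => ?_, fun y => ?_, by simpa using hc, ?_⟩
  · simp only [Finset.mem_filter, Finset.mem_univ, true_and]
    rw [eq_comm, hq, eq_comm, hq]
    exact ⟨fun h => by simpa [ha y] using h2 _ h, h2 y⟩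
  · simp only [Finset.mem_filter, Finset.mem_univ, true_and]
    rw [eq_comm, hq, eq_comm, hq]
    exact ⟨fun h => by simpa [hb y] using h3 _ h, h3 y⟩
  · refine card_fixed_le_two ha.toPerm hb.toPerm ha hb x hax _ fun y hy => ?_
    simp only [Finset.mem_filter, Finset.mem_univ, true_and] at hy
    exact ⟨hX y hy.1, (hq _ _).1 hy.2.symm⟩

/-! ### Extending an edge colouring to a new vertex -/

/-- Colour classes `σ i` with `i ∈ C`, given as involutions, none of which meets `v`, and for
every `u ∈ N` a set `A u` of `d u` colours missing at `u`. -/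
structure IsState (C : Finset ι) (N : Finset V) (v : V) (d : V → ℕ) (σ : ι → V → V)
    (A : V → Finset ι) : Prop where
  invol : ∀ i, Involutive (σ i)
  fix : ∀ i, σ i v = v
  sub : ∀ u ∈ N, A u ⊆ C
  avail : ∀ u ∈ N, ∀ i ∈ A u, σ i u = u
  card : ∀ u ∈ N, (A u).card = d u

/-- Every edge with a colour in `C` under `σ` has one under `τ`. -/
def Covers (C : Finset ι) (σ τ : ι → V → V) : Prop :=
  ∀ x y, x ≠ y → (∃ i ∈ C, σ i x = y) → ∃ i ∈ C, τ i x = y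

/-- Swapping colours `i` and `j` on a Kempe set moves a surplus of at most two from `i` to `j`. As
the counts differ by more than two, the sum of squares drops; it serves as the measure for descent.
-/
theorem IsState.exists_kempe [DecidableEq V] [DecidableEq ι] [Fintype V] {C : Finset ι}
    {N : Finset V} {v : V} {d : V → ℕ}
    {σ : ι → V → V} {A : V → Finset ι} (h : IsState C N v d σ A) {i j : ι} (hi : i ∈ C)
    (hj : j ∈ C) (hij : (N.filter (j ∈ A ·)).card + 2 < (N.filter (i ∈ A ·)).card) :
    ∃ σ' A', IsState C N v d σ' A' ∧ Covers C σ σ' ∧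
      ∑ l ∈ C, (N.filter (l ∈ A' ·)).card ^ 2 < ∑ l ∈ C, (N.filter (l ∈ A ·)).card ^ 2 := by
  obtain ⟨S, hSi, hSj, hlt, hle⟩ := exists_kempe_set (σ i) (σ j) (h.invol i) (h.invol j)
    (N.filter (i ∈ A ·)) (N.filter (j ∈ A ·))
    (fun x hx => by
      rw [Finset.mem_filter] at hx
      exact h.avail x hx.1 i hx.2) (by omega)
  have hne : i ≠ j := by rintro rfl; omega
  have hsC : ∀ l ∈ C, Equiv.swap i j l ∈ C := by
    intro l hl
    rw [Equiv.swap_apply_def]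
    split_ifs <;> assumption
  let σ' : ι → V → V := fun l x => if x ∈ S then σ (Equiv.swap i j l) x else σ l x
  let A' : V → Finset ι := fun u => if u ∈ S then (A u).map (Equiv.swap i j).toEmbedding else A u
  have hA' : ∀ u l, l ∈ A' u ↔ if u ∈ S then Equiv.swap i j l ∈ A u else l ∈ A u := by
    intro u l
    by_cases hu : u ∈ S
    · simp only [A', hu, if_true, Finset.mem_map_equiv, Equiv.symm_swap]
    · simp only [A', hu, if_false]
  have hσ : ∀ l, l ≠ i → l ≠ j → σ' l = σ l := by
    intro l h1 h2
    funext x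
    simp only [σ', Equiv.swap_apply_of_ne_of_ne h1 h2, ite_self]
  have hinv : ∀ l, Involutive (σ' l) := by
    intro l
    by_cases h1 : l = i
    · subst h1
      intro x
      by_cases hx : x ∈ S
      · simp [σ', hx, hSj, h.invol j x]
      · simp [σ', hx, hSi, h.invol l x]
    · by_cases h2 : l = j
      · subst h2
        intro x
        by_cases hx : x ∈ S
        · simp [σ', hx, hSi, h.invol i x]
        · simp [σ', hx, hSj, h.invol l x]
      · rw [hσ l h1 h2]; exact h.invol l
  have hcount : ∀ l m, Equiv.swap i j l = m → (N.filter (l ∈ A' ·)).card =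
      ((N.filter (l ∈ A ·)).filter (· ∉ S)).card + ((N.filter (m ∈ A ·)).filter (· ∈ S)).card := by
    rintro l m rfl
    rw [← Finset.card_filter_add_card_filter_not (s := N.filter (l ∈ A' ·)) (p := (· ∈ S)), add_comm,
      Finset.filter_filter, Finset.filter_filter, Finset.filter_filter, Finset.filter_filter]
    congr 2
    · ext u
      simp only [Finset.mem_filter, hA']
      by_cases hu : u ∈ S <;> simp [hu]
    · ext u
      simp only [Finset.mem_filter, hA']
      by_cases hu : u ∈ S <;> simp [hu]
  refine ⟨σ', A', ⟨hinv, ?_, ?_, ?_, ?_⟩, ?_, ?_⟩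
  · intro l
    simp only [σ', h.fix, ite_self]
  · intro u hu l hl
    rw [hA'] at hl
    split_ifs at hl
    · simpa using hsC _ (h.sub u hu hl)
    · exact h.sub u hu hl
  · intro u hu l hl
    rw [hA'] at hl
    by_cases hS' : u ∈ S
    · simp only [hS', if_true] at hl
      simpa [σ', hS'] using h.avail u hu _ hl
    · simp only [hS', if_false] at hl
      simpa [σ', hS'] using h.avail u hu _ hl
  · intro u hu
    simp only [A']
    split_ifs
    · rw [Finset.card_map, h.card u hu]
    · exact h.card u hu
  · rintro x y - ⟨l, hl, rfl⟩
    by_cases hx : x ∈ S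
    · exact ⟨Equiv.swap i j l, hsC l hl, by simp [σ', hx]⟩
    · exact ⟨l, hl, by simp [σ', hx]⟩
  · have hj' : j ∈ C.erase i := Finset.mem_erase.2 ⟨hne.symm, hj⟩
    rw [← Finset.add_sum_erase C _ hi, ← Finset.add_sum_erase C _ hi,
      ← Finset.add_sum_erase _ _ hj', ← Finset.add_sum_erase _ _ hj']
    have hrest : ∑ l ∈ (C.erase i).erase j, (N.filter (l ∈ A' ·)).card ^ 2 =
        ∑ l ∈ (C.erase i).erase j, (N.filter (l ∈ A ·)).card ^ 2 := by
      refine Finset.sum_congr rfl fun l hl => ?_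
      simp only [Finset.mem_erase] at hl
      congr 2
      ext u
      simp only [Finset.mem_filter, hA', Equiv.swap_apply_of_ne_of_ne hl.2.1 hl.1, ite_self]
    rw [hrest, hcount i j (by simp), hcount j i (by simp)]
    have e1 := Finset.card_filter_add_card_filter_not (s := N.filter (i ∈ A ·)) (p := (· ∈ S))
    have e2 := Finset.card_filter_add_card_filter_not (s := N.filter (j ∈ A ·)) (p := (· ∈ S))
    rw [← e1, ← e2] at hij ⊢
    generalize ((N.filter (i ∈ A ·)).filter (· ∈ S)).card = p at *
    generalize ((N.filter (i ∈ A ·)).filter (· ∉ S)).card = q at *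
    generalize ((N.filter (j ∈ A ·)).filter (· ∈ S)).card = s at *
    generalize ((N.filter (j ∈ A ·)).filter (· ∉ S)).card = t at *
    -- The difference of the two sides is `2 (p - s) (q - t)`; `q > t` follows from `p ≤ 2` and the
    -- gap in `hij`.
    have : (q + s) ^ 2 + (t + p) ^ 2 < (p + q) ^ 2 + (s + t) ^ 2 := by
      have h1 : s < p := hlt
      have h2 : t < q := by omega
      nlinarith
    omega

theorem Covers.trans {C : Finset ι} {σ τ ρ : ι → V → V} (h : Covers C σ τ) (h' : Covers C τ ρ) :
    Covers C σ ρ := fun x y hxy hi => h' x y hxy (h x y hxy hi)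

/-- After Kempe exchanges some colour is available at exactly one vertex of `N`. -/
theorem IsState.exists_unique_avail [DecidableEq V] [DecidableEq ι] [Fintype V] {C : Finset ι}
    {N : Finset V} {v : V} {d : V → ℕ} (hodd : Odd (∑ u ∈ N, d u))
    (hlt : ∑ u ∈ N, d u < 2 * C.card) (n : ℕ) {σ : ι → V → V} {A : V → Finset ι}
    (h : IsState C N v d σ A) (hn : ∑ l ∈ C, (N.filter (l ∈ A ·)).card ^ 2 = n) :
    ∃ σ' A', IsState C N v d σ' A' ∧ Covers C σ σ' ∧ ∃ i ∈ C, (N.filter (i ∈ A' ·)).card = 1 := by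
  induction n using Nat.strong_induction_on generalizing σ A with
  | _ n ih =>
  by_cases hex : ∃ i ∈ C, ∃ j ∈ C, (N.filter (j ∈ A ·)).card + 2 < (N.filter (i ∈ A ·)).card
  · obtain ⟨i, hi, j, hj, hij⟩ := hex
    obtain ⟨σ₁, A₁, h₁, c₁, l₁⟩ := h.exists_kempe hi hj hij
    obtain ⟨σ₂, A₂, h₂, c₂, l₂⟩ := ih _ (hn ▸ l₁) h₁ rfl
    exact ⟨σ₂, A₂, h₂, c₁.trans c₂, l₂⟩
  · push Not at hex
    refine ⟨σ, A, h, fun x y _ hi => hi, ?_⟩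
    -- All counts now lie within 2 of each other, and their average is below 2, so some count is
    -- below 2. If no count is 1, that one is 0 and all are 0 or 2, contradicting the odd total.
    by_contra! hne
    have hsum : ∑ l ∈ C, (N.filter (l ∈ A ·)).card = ∑ u ∈ N, d u := by
      simp only [Finset.card_filter]
      rw [Finset.sum_comm]
      refine Finset.sum_congr rfl fun u hu => ?_
      rw [← h.card u hu, ← Finset.card_filter, Finset.filter_mem_eq_inter,
        Finset.inter_eq_right.2 (h.sub u hu)]
    obtain ⟨j, hj, hj2⟩ : ∃ j ∈ C, (N.filter (j ∈ A ·)).card < 2 := by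
      by_contra! h2
      have := Finset.card_nsmul_le_sum C _ 2 h2
      rw [hsum, smul_eq_mul] at this
      omega
    rw [← hsum] at hodd
    refine (Nat.not_odd_iff_even.2 (Finset.even_sum _ fun i hi => ?_)) hodd
    have h1 := hex i hi j hj
    have h2 := hne i hi
    have h3 := hne j hj
    have h4 : (N.filter (i ∈ A ·)).card = 0 ∨ (N.filter (i ∈ A ·)).card = 2 := by omega
    rcases h4 with h4 | h4 <;> rw [h4] <;> decide

/-- A proper edge colouring extends to the edges from a new vertex `v` to the vertices in `N`, if
two colours are missing at all but at most one vertex of `N` and one is missing there. -/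
theorem exists_extension [DecidableEq V] [DecidableEq ι] [Fintype V] (C : Finset ι)
    (N : Finset V) (v u₀ : V) (hv : v ∉ N) (hN : N.card ≤ C.card) (σ : ι → V → V)
    (A : V → Finset ι) (h1 : ∀ i, Involutive (σ i)) (h2 : ∀ i, σ i v = v)
    (h3 : ∀ u ∈ N, A u ⊆ C) (h4 : ∀ u ∈ N, ∀ i ∈ A u, σ i u = u)
    (h5 : ∀ u ∈ N, (if u = u₀ then 1 else 2) ≤ (A u).card) :
    ∃ τ : ι → V → V, (∀ i, Involutive (τ i)) ∧ Covers C σ τ ∧ ∀ u ∈ N, ∃ i ∈ C, τ i v = u := by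
  induction hk : C.card generalizing C N u₀ σ A with
  | zero =>
    have : N = ∅ := Finset.card_eq_zero.1 (by omega)
    subst this
    exact ⟨σ, h1, fun x y _ h => h, by simp⟩
  | succ k ih =>
  rcases N.eq_empty_or_nonempty with rfl | hne
  · exact ⟨σ, h1, fun x y _ h => h, by simp⟩
  -- The exceptional vertex is taken inside `N`, so that trimming the lists to sizes 1 and 2 makes
  -- their total exactly `2 * N.card - 1`, which is odd.
  obtain ⟨u₁, hu₁, h5'⟩ : ∃ u₁ ∈ N, ∀ u ∈ N, (if u = u₁ then 1 else 2) ≤ (A u).card := by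
    by_cases h0 : u₀ ∈ N
    · exact ⟨u₀, h0, h5⟩
    · obtain ⟨u₁, hu₁⟩ := hne
      refine ⟨u₁, hu₁, fun u hu => ?_⟩
      have := h5 u hu
      rw [if_neg (fun e : u = u₀ => h0 (e ▸ hu))] at this
      split_ifs <;> omega
  have hB : ∀ u, ∃ B : Finset ι, u ∈ N → B ⊆ A u ∧ B.card = if u = u₁ then 1 else 2 := by
    intro u
    by_cases hu : u ∈ N
    · obtain ⟨B, hB⟩ := Finset.exists_subset_card_eq (h5' u hu)
      exact ⟨B, fun _ => hB⟩
    · exact ⟨∅, fun h => absurd h hu⟩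
  choose B hB using hB
  have hst : IsState C N v (fun u => if u = u₁ then 1 else 2) σ B :=
    ⟨h1, h2, fun u hu => (hB u hu).1.trans (h3 u hu),
      fun u hu i hi => h4 u hu i ((hB u hu).1 hi), fun u hu => (hB u hu).2⟩
  have hsum : ∑ u ∈ N, (if u = u₁ then 1 else 2) = 2 * (N.card - 1) + 1 := by
    rw [← Finset.add_sum_erase _ _ hu₁, if_pos rfl, Finset.sum_congr rfl (g := fun _ => 2)
      (fun u hu => if_neg (Finset.ne_of_mem_erase hu)), Finset.sum_const,
      Finset.card_erase_of_mem hu₁, smul_eq_mul]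
    ring
  have hpos := Finset.card_pos.2 hne
  obtain ⟨σ', A', hst', hcov, i, hi, hi1⟩ := hst.exists_unique_avail
    (by rw [hsum]; exact ⟨_, rfl⟩) (by rw [hsum]; omega) _ rfl
  obtain ⟨u, hu⟩ := Finset.card_eq_one.1 hi1
  have huN : u ∈ N ∧ i ∈ A' u := by
    have : u ∈ N.filter (i ∈ A' ·) := by rw [hu]; simp
    exact Finset.mem_filter.1 this
  have hui : σ' i u = u := hst'.avail u huN.1 i huN.2
  have huv : u ≠ v := fun e => hv (e ▸ huN.1)
  have hother : ∀ w ∈ N.erase u, i ∉ A' w := by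
    intro w hw hiw
    have : w ∈ N.filter (i ∈ A' ·) := Finset.mem_filter.2 ⟨Finset.mem_of_mem_erase hw, hiw⟩
    rw [hu, Finset.mem_singleton] at this
    exact Finset.ne_of_mem_erase hw this
  -- Colour `i` is reserved for the edge `vu`. It is listed at no other vertex of `N`, so dropping
  -- it from the palette shortens no remaining list.
  obtain ⟨τ, ht1, ht2, ht3⟩ := ih (C.erase i) (N.erase u) u₁
    (fun h => hv (Finset.mem_of_mem_erase h))
    (by rw [Finset.card_erase_of_mem hi, Finset.card_erase_of_mem huN.1]; omega) σ' A'
    hst'.invol hst'.fix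
    (fun w hw l hl => Finset.mem_erase.2 ⟨fun e => hother w hw (e ▸ hl),
      hst'.sub w (Finset.mem_of_mem_erase hw) hl⟩)
    (fun w hw => hst'.avail w (Finset.mem_of_mem_erase hw))
    (fun w hw => (hst'.card w (Finset.mem_of_mem_erase hw)).ge)
    (by rw [Finset.card_erase_of_mem hi]; omega)
  -- The class of colour `i` with the edge `vu` added; both ends were unmatched in it.
  let ρ : V → V := fun x => if x = v then u else if x = u then v else σ' i x
  have hρ : Involutive ρ := by
    intro x
    by_cases hxv : x = v
    · simp [ρ, hxv, huv]
    by_cases hxu : x = u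
    · simp [ρ, hxu, huv]
    have e1 : σ' i x ≠ v := fun e => hxv (by rw [← hst'.invol i x, e, hst'.fix])
    have e2 : σ' i x ≠ u := fun e => hxu (by rw [← hst'.invol i x, e, hui])
    simp [ρ, hxv, hxu, e1, e2, hst'.invol i x]
  refine ⟨Function.update τ i ρ, ?_, hcov.trans ?_, ?_⟩
  · intro l
    by_cases hl : l = i
    · subst hl; simpa using hρ
    · simpa [hl] using ht1 l
  · rintro x y hxy ⟨l, hl, rfl⟩
    by_cases hli : l = i
    · subst hli
      refine ⟨l, hl, ?_⟩
      have e1 : x ≠ v := by rintro rfl; exact hxy (hst'.fix l).symm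
      have e2 : x ≠ u := by rintro rfl; exact hxy hui.symm
      simp [ρ, e1, e2]
    · obtain ⟨m, hm, hm'⟩ := ht2 x _ hxy ⟨l, Finset.mem_erase.2 ⟨hli, hl⟩, rfl⟩
      rw [Finset.mem_erase] at hm
      exact ⟨m, hm.2, by simpa [hm.1] using hm'⟩
  · intro w hw
    by_cases hwu : w = u
    · subst hwu
      exact ⟨i, hi, by simp [ρ]⟩
    · obtain ⟨m, hm, hm'⟩ := ht3 w (Finset.mem_erase.2 ⟨hwu, hw⟩)
      rw [Finset.mem_erase] at hm
      exact ⟨m, hm.2, by simpa [hm.1] using hm'⟩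

/-! ### Vizing's theorem -/

/-- The colour classes can be made disjoint and restricted to the edges of a given graph. -/
theorem exists_prune [LinearOrder ι] [Fintype ι] (H : SimpleGraph V) (σ : ι → V → V)
    (h1 : ∀ i, Involutive (σ i)) (h2 : ∀ x y, H.Adj x y → ∃ i, σ i x = y) :
    ∃ τ : ι → V → V, (∀ i, Involutive (τ i)) ∧ (∀ x y, H.Adj x y → ∃ i, τ i x = y) ∧
      (∀ i x, τ i x ≠ x → H.Adj x (τ i x)) ∧
      ∀ x i j, τ i x ≠ x → τ i x = τ j x → i = j := by
  classical
  -- An edge of `H` is kept only in the least colour that contains it.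
  let P : ι → V → Prop := fun i x => H.Adj x (σ i x) ∧ ∀ j < i, σ j x ≠ σ i x
  have hP : ∀ i x, P i x → P i (σ i x) := by
    rintro i x ⟨h, h'⟩
    refine ⟨by rw [h1 i x]; exact h.symm, fun j hj e => h' j hj ?_⟩
    rw [h1 i x] at e
    rw [← e, h1 j, e]
  refine ⟨fun i x => if P i x then σ i x else x, ?_, ?_, ?_, ?_⟩
  · intro i x
    by_cases h : P i x
    · simp [h, hP i x h, h1 i x]
    · simp [h]
  · intro x y hxy
    have hne : (Finset.univ.filter (fun i => σ i x = y)).Nonempty := by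
      obtain ⟨i, hi⟩ := h2 x y hxy
      exact ⟨i, by simpa using hi⟩
    have hm := Finset.min'_mem _ hne
    set i := Finset.min' _ hne with hi
    have hi' : σ i x = y := by simpa using hm
    refine ⟨i, ?_⟩
    have : P i x := by
      refine ⟨hi' ▸ hxy, fun j hj e => ?_⟩
      have := Finset.min'_le (Finset.univ.filter (fun i => σ i x = y)) j (by simpa [hi'] using e)
      exact absurd hj (not_lt.2 this)
    simp [this, hi']
  · intro i x h
    by_cases h' : P i x
    · simpa [h'] using h'.1
    · simp [h'] at h
  · intro x i j hi hij
    by_cases h' : P i x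
    · by_cases h'' : P j x
      · simp only [h', h'', if_true] at hij
        rcases lt_trichotomy i j with h | h | h
        · exact absurd hij (h''.2 i h)
        · exact h
        · exact absurd hij.symm (h'.2 j h)
      · simp only [h', h'', if_true, if_false] at hij hi
        exact absurd hij hi
    · simp [h'] at hi

/-- **Vizing's theorem**: a finite graph with degrees at most `D` has a proper edge colouring with
`D + 1` colours. The colour classes are given as involutions. -/
theorem vizing [Fintype V] (H : SimpleGraph V) (D : ℕ)
    (hD : ∀ v, (H.neighborSet v).ncard ≤ D) :
    ∃ σ : Fin (D + 1) → V → V, (∀ i, Involutive (σ i)) ∧ (∀ x y, H.Adj x y → ∃ i, σ i x = y) ∧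
      ∀ i x, σ i x ≠ x → H.Adj x (σ i x) := by
  classical
  have hD' : ∀ v, (H.neighborFinset v).card ≤ D := fun v => by
    rw [← Set.ncard_coe_finset, SimpleGraph.coe_neighborFinset]; exact hD v
  suffices h : ∀ S : Finset V, ∃ σ : Fin (D + 1) → V → V, (∀ i, Involutive (σ i)) ∧
      ∀ x y, x ∈ S → y ∈ S → H.Adj x y → ∃ i, σ i x = y by
    obtain ⟨σ, h1, h2⟩ := h Finset.univ
    obtain ⟨τ, h3, h4, h5, -⟩ := exists_prune H σ h1 fun x y => h2 x y (by simp) (by simp)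
    exact ⟨τ, h3, h4, h5⟩
  intro S
  induction S using Finset.induction_on with
  | empty => exact ⟨fun _ => id, fun _ _ => rfl, by simp⟩
  | insert v S hv ih =>
  obtain ⟨σ₀, h1, h2⟩ := ih
  let HS : SimpleGraph V :=
    { Adj := fun x y => x ∈ S ∧ y ∈ S ∧ H.Adj x y
      symm := ⟨fun x y h => ⟨h.2.1, h.1, h.2.2.symm⟩⟩
      loopless := ⟨fun x h => H.irrefl h.2.2⟩ }
  -- Pruning frees `v` of all colours and makes distinct colours used at a vertex lead to distinct
  -- neighbours.
  obtain ⟨σ, h3, h4, h5, h6⟩ := exists_prune HS σ₀ h1 fun x y h => h2 x y h.1 h.2.1 h.2.2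
  let N := (H.neighborFinset v).filter (· ∈ S)
  have hvN : v ∉ N := by simp [N]
  obtain ⟨τ, t1, t2, t3⟩ := exists_extension (Finset.univ : Finset (Fin (D + 1))) N v v hvN
    (by
      rw [Finset.card_univ, Fintype.card_fin]
      exact (Finset.card_filter_le _ _).trans ((hD' v).trans (Nat.le_succ D))) σ
    (fun u => Finset.univ.filter fun i => σ i u = u) h3
    (fun i => by
      by_contra h
      exact hv (h5 i v h).1)
    (fun _ _ => Finset.subset_univ _) (fun u _ i hi => by simpa using hi)
    (fun u hu => by
      rw [if_neg (fun e : u = v => hvN (e ▸ hu))]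
      -- Colours used at `u` inject into its neighbours other than `v`, so at most `D - 1` are used
      -- and at least two of the `D + 1` are missing.
      have hle : (Finset.univ.filter fun i => ¬ σ i u = u).card ≤
          ((H.neighborFinset u).erase v).card := by
        refine Finset.card_le_card_of_injOn (fun i => σ i u) ?_ ?_
        · intro i hi
          have hi' : σ i u ≠ u := by simpa using hi
          have := h5 i u hi'
          simp only [Finset.coe_erase, SimpleGraph.coe_neighborFinset, Set.mem_sdiff,
            SimpleGraph.mem_neighborSet, Set.mem_singleton_iff]
          exact ⟨this.2.2, fun e => hv (e ▸ this.2.1)⟩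
        · intro i hi j _ hij
          exact h6 u i j (by simpa using hi) hij
      have hvu : v ∈ H.neighborFinset u := by
        have : H.Adj v u := by simpa [N] using (Finset.mem_filter.1 hu).1
        simpa using this.symm
      have hpos := Finset.card_pos.2 ⟨v, hvu⟩
      rw [Finset.card_erase_of_mem hvu] at hle
      have := Finset.card_filter_add_card_filter_not (s := (Finset.univ : Finset (Fin (D + 1))))
        (p := fun i => σ i u = u)
      rw [Finset.card_univ, Fintype.card_fin] at this
      have := hD' u
      omega)
  refine ⟨τ, t1, fun x y hx hy hxy => ?_⟩
  have hmem : ∀ u, u ∈ S → H.Adj v u → ∃ i, τ i v = u := by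
    intro u hu hvu
    obtain ⟨i, -, hi⟩ := t3 u (by simp [N, hu, hvu])
    exact ⟨i, hi⟩
  rw [Finset.mem_insert] at hx hy
  rcases hx with rfl | hx <;> rcases hy with rfl | hy
  · exact absurd hxy (H.irrefl)
  · exact hmem y hy hxy
  · obtain ⟨i, hi⟩ := hmem x hx hxy.symm
    exact ⟨i, by rw [← hi, t1 i]⟩
  · obtain ⟨i, hi⟩ := h4 x y ⟨hx, hy, hxy⟩
    obtain ⟨j, -, hj⟩ := t2 x y hxy.ne ⟨i, Finset.mem_univ _, hi⟩
    exact ⟨j, hj⟩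

end EdgeColoring

/-! ### Random cuts from a contracted matching -/

namespace MaxCut

open Function

variable {V : Type*}

/-- A symmetric irreflexive relation in which every element has at most one partner comes from an
involution. -/
theorem exists_involution (R : V → V → Prop) (hs : ∀ x y, R x y → R y x) (hi : ∀ x, ¬ R x x)
    (hu : ∀ x y z, R x y → R x z → y = z) :
    ∃ m : V → V, Involutive m ∧ ∀ x y, R x y ↔ x ≠ y ∧ m x = y := by
  classical
  let m : V → V := fun x => if h : ∃ y, R x y then h.choose else x
  have h1 : ∀ x y, R x y → m x = y := by
    intro x y h
    have h' : ∃ y, R x y := ⟨y, h⟩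
    simp only [m, h', dif_pos]
    exact hu x _ _ h'.choose_spec h
  have h2 : ∀ x, (¬ ∃ y, R x y) → m x = x := by
    intro x h
    simp only [m, h, dif_neg, not_false_iff]
  refine ⟨m, fun x => ?_, fun x y => ⟨fun h => ⟨fun e => hi x (e ▸ h), h1 x y h⟩, ?_⟩⟩
  · by_cases h : ∃ y, R x y
    · obtain ⟨y, hy⟩ := h
      rw [h1 x y hy, h1 y x (hs x y hy)]
    · rw [h2 x h, h2 x h]
  · rintro ⟨hne, rfl⟩
    by_cases h : ∃ y, R x y
    · obtain ⟨y, hy⟩ := h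
      rwa [h1 x y hy]
    · exact absurd (h2 x h).symm hne

/-- The graph obtained from `G` by identifying vertices along `q`, without loops. -/
def contraction {W : Type*} (G : SimpleGraph V) (q : V → W) : SimpleGraph W where
  Adj P Q := P ≠ Q ∧ ∃ x y, q x = P ∧ q y = Q ∧ G.Adj x y
  symm := ⟨fun _ _ ⟨h, x, y, hx, hy, hxy⟩ => ⟨h.symm, y, x, hy, hx, hxy.symm⟩⟩
  loopless := ⟨fun _ h => h.1 rfl⟩

/-- In a triangle-free graph the union of at most two adjacent blocks `{x, m x}` induces a bipartite
graph. -/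
theorem exists_bipartition {W : Type*} [DecidableEq W] (G : SimpleGraph V) (hG : G.CliqueFree 3)
    (m : V → V) (hm : ∀ x, m x ≠ x → G.Adj x (m x)) (q : V → W)
    (hq : ∀ x y, q x = q y ↔ x = y ∨ x = m y) (σ : W → W)
    (hσ : ∀ P, σ P ≠ P → (contraction G q).Adj P (σ P)) (c : Finset W) :
    ∃ b : V → Bool, ∀ z z', G.Adj z z' → ({q z, σ (q z)} : Finset W) = c →
      ({q z', σ (q z')} : Finset W) = c → b z ≠ b z' := by
  classical
  have tri : ∀ x y z, G.Adj x y → G.Adj x z → G.Adj y z → False := fun x y z h1 h2 h3 =>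
    hG {x, y, z} (SimpleGraph.is3Clique_triple_iff.2 ⟨h1, h2, h3⟩)
  by_cases h : ∃ x₀, ({q x₀, σ (q x₀)} : Finset W) = c
  swap
  · exact ⟨fun _ => true, fun z _ _ hz => absurd ⟨z, hz⟩ h⟩
  obtain ⟨x₀, hx₀⟩ := h
  have hmem : ∀ z, ({q z, σ (q z)} : Finset W) = c →
      q z = q x₀ ∨ q z = σ (q x₀) := by
    intro z hz
    have : q z ∈ ({q x₀, σ (q x₀)} : Finset W) := hx₀ ▸ hz ▸ by simp
    simpa using this
  by_cases hfix : σ (q x₀) = q x₀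
  · refine ⟨fun z => decide (z = x₀), fun z z' hzz hz hz' => ?_⟩
    have h1 := hmem z hz
    have h2 := hmem z' hz'
    rw [hfix, or_self, hq] at h1 h2
    have := hzz.ne
    by_cases e1 : z = x₀ <;> by_cases e2 : z' = x₀ <;> simp_all
  · obtain ⟨-, x, y, hx, hy, hxy⟩ := hσ _ hfix
    rw [← hy, ← hx] at hmem
    simp only [hq] at hmem
    have hy' : m y = y ∨ G.Adj (m y) y := by
      by_cases h : m y = y
      · exact Or.inl h
      · exact Or.inr (hm y h).symm
    -- Split by adjacency to `y`: two adjacent neighbours of `y` would form a triangle with it, and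
    -- the non-neighbours are among `y` and `m x`, which could only be adjacent if `m x` were a
    -- neighbour of `y`.
    refine ⟨fun z => decide (G.Adj z y), fun z z' hzz hz hz' => ?_⟩
    have hfalse : ∀ z, (z = x ∨ z = m x) ∨ z = y ∨ z = m y → ¬ G.Adj z y → z = m x ∨ z = y := by
      rintro z ((rfl | rfl) | rfl | rfl) h
      · exact absurd hxy h
      · exact Or.inl rfl
      · exact Or.inr rfl
      · exact Or.inr (hy'.resolve_right h)
    by_cases h1 : G.Adj z y <;> by_cases h2 : G.Adj z' y
    · exact (tri _ _ _ hzz h1 h2).elim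
    · simp [h1, h2]
    · simp [h1, h2]
    · rcases hfalse z (hmem z hz) h1 with e1 | e1 <;> rcases hfalse z' (hmem z' hz') h2 with e2 | e2
      · exact absurd (e1.trans e2.symm) hzz.ne
      · exact absurd (e2 ▸ hzz) h1
      · exact absurd (e1 ▸ hzz.symm) h2
      · exact absurd (e1.trans e2.symm) hzz.ne

/-- Independent fair flips separate two different components with probability one half. -/
theorem two_mul_sum_flips {C : Type*} [Fintype C] [DecidableEq C] {p q : C} (hpq : p ≠ q)
    (b b' : Bool) :
    2 * ∑ s : C → Bool, (if xor b (s p) ≠ xor b' (s q) then (1 : ℝ) else 0) =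
      Fintype.card (C → Bool) := by
  -- Flipping the coin at `p` alone pairs each outcome that separates with one that does not.
  have hinv : Involutive fun s : C → Bool => update s p (!s p) := by
    intro s
    simp
  rw [two_mul]
  nth_rewrite 2 [← Equiv.sum_comp hinv.toPerm]
  rw [← Finset.sum_add_distrib, Finset.sum_congr rfl (g := fun _ => (1 : ℝ))]
  · simp
  · intro s _
    simp only [Involutive.coe_toPerm, update_self, update_of_ne hpq.symm]
    cases b <;> cases b' <;> cases s p <;> cases s q <;> simp

theorem cutWeight_eq_sum [Finite V] (G : SimpleGraph V) (w : Sym2 V → ℝ) (A : Set V)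
    [DecidablePred (· ∈ (G.between A Aᶜ).edgeSet)] :
    cutWeight G w A = ∑ e ∈ G.edgeSet.toFinite.toFinset,
      w e * if e ∈ (G.between A Aᶜ).edgeSet then 1 else 0 := by
  simp only [mul_ite, mul_one, mul_zero]
  rw [← Finset.sum_filter, cutWeight, weight]
  congr 1
  ext e
  simp only [Set.Finite.mem_toFinset, Finset.mem_filter]
  exact ⟨fun h => ⟨SimpleGraph.edgeSet_mono SimpleGraph.between_le h, h⟩, fun h => h.2⟩

/-- If `S` is the matching of `G` with partner function `m`, and the graph obtained by contracting
`S` has maximum degree at most `D`, then some cut contains `S` and a proportion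
`(D + 2) / (2 * (D + 1))` of the weight of the remaining edges. -/
theorem mac_ge_of_contraction [Fintype V] [DecidableEq V] (G : SimpleGraph V) (w : Sym2 V → ℝ)
    (hw : ∀ e ∈ G.edgeSet, 0 ≤ w e) (hG : G.CliqueFree 3) (S : Set (Sym2 V)) (hS : S ⊆ G.edgeSet)
    (m : V → V) (hinv : Involutive m) (hm : ∀ x y, s(x, y) ∈ S ↔ x ≠ y ∧ m x = y) (D : ℕ)
    (hD : ∀ P, ((contraction G fun x => ({x, m x} : Finset V)).neighborSet P).ncard ≤ D) :
    (D + 2) * weight w G.edgeSet + D * weight w S ≤ 2 * (D + 1) * mac G w := by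
  classical
  let q : V → Finset V := fun x => {x, m x}
  have hq : ∀ x y, q x = q y ↔ x = y ∨ x = m y := by
    intro x y
    constructor
    · intro h
      have : x ∈ q y := h ▸ by simp [q]
      simpa [q] using this
    · rintro (rfl | rfl)
      · rfl
      · simp only [q, hinv y, Finset.pair_comm]
  obtain ⟨σ, h1, h2, h3⟩ := EdgeColoring.vizing (contraction G q) D hD
  have hadj : ∀ x, m x ≠ x → G.Adj x (m x) := fun x hx =>
    hS ((hm x (m x)).2 ⟨hx.symm, rfl⟩)
  choose b hb using fun i => exists_bipartition G hG m hadj q hq (σ i) (h3 i)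
  -- `f i x` names the component of `x` for colour `i`: its block together with the partner block,
  -- if any. The coins `s` are indexed by these names.
  let f : Fin (D + 1) → V → Finset (Finset V) := fun i x => {q x, σ i (q x)}
  let t : Fin (D + 1) → (Finset (Finset V) → Bool) → V → Bool := fun i s x =>
    xor (b i (f i x) x) (s (f i x))
  let A : Fin (D + 1) → (Finset (Finset V) → Bool) → Set V := fun i s => {x | t i s x = true}
  set N : ℝ := (Fintype.card (Finset (Finset V) → Bool) : ℝ) with hN
  have hNpos : 0 < N := by
    rw [hN]; exact_mod_cast Fintype.card_pos
  have hcut : ∀ i s x y, G.Adj x y →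
      (s(x, y) ∈ (G.between (A i s) (A i s)ᶜ).edgeSet ↔ t i s x ≠ t i s y) := by
    intro i s x y hxy
    simp only [SimpleGraph.mem_edgeSet, SimpleGraph.between_adj, hxy, true_and, A,
      Set.mem_compl_iff, Set.mem_ofPred_eq]
    cases t i s x <;> cases t i s y <;> simp
  have hsame : ∀ i x y, G.Adj x y → f i x = f i y →
      2 * ∑ s, (if s(x, y) ∈ (G.between (A i s) (A i s)ᶜ).edgeSet then (1 : ℝ) else 0) = 2 * N := by
    intro i x y hxy hf
    rw [Finset.sum_congr rfl (g := fun _ => (1 : ℝ))]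
    · simp [hN]
    · intro s _
      rw [if_pos]
      rw [hcut i s x y hxy]
      have := hb i (f i x) x y hxy rfl hf.symm
      simpa [t, ← hf] using this
  have hdiff : ∀ i x y, G.Adj x y → f i x ≠ f i y →
      2 * ∑ s, (if s(x, y) ∈ (G.between (A i s) (A i s)ᶜ).edgeSet then (1 : ℝ) else 0) = N := by
    intro i x y hxy hf
    simp only [hcut i _ x y hxy]
    exact two_mul_sum_flips hf _ _
  have hge : ∀ i x y, G.Adj x y →
      N ≤ 2 * ∑ s, (if s(x, y) ∈ (G.between (A i s) (A i s)ᶜ).edgeSet then (1 : ℝ) else 0) := by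
    intro i x y hxy
    by_cases hf : f i x = f i y
    · rw [hsame i x y hxy hf]; linarith
    · rw [hdiff i x y hxy hf]
  -- An edge within a block gets `2 * N` from each of the `D + 1` colours. Any other edge gets `2 *
  -- N` from the colour of its image and at least `N` from each of the other `D`, in total at least
  -- `(D + 2) * N`.
  have hedge : ∀ e ∈ G.edgeSet, N * ((D + 2) + if e ∈ S then (D : ℝ) else 0) ≤
      ∑ i, 2 * ∑ s, (if e ∈ (G.between (A i s) (A i s)ᶜ).edgeSet then (1 : ℝ) else 0) := by
    intro e
    induction e using Sym2.ind with
    | _ x y =>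
    intro hxy
    rw [SimpleGraph.mem_edgeSet] at hxy
    by_cases hq' : q x = q y
    · rw [Finset.sum_congr rfl fun i _ => hsame i x y hxy (by simp only [f, hq'])]
      simp only [Finset.sum_const, Finset.card_univ, Fintype.card_fin, nsmul_eq_mul]
      push_cast
      split_ifs <;> nlinarith [(Nat.cast_nonneg D : (0 : ℝ) ≤ D)]
    · have hnS : s(x, y) ∉ S := by
        rw [hm]
        rintro ⟨-, rfl⟩
        exact hq' ((hq _ _).2 (Or.inr (hinv x).symm))
      obtain ⟨i, hi⟩ := h2 (q x) (q y) ⟨hq', x, y, rfl, rfl, hxy⟩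
      have hfi : f i x = f i y := by
        simp only [f]
        rw [← hi, h1 i, Finset.pair_comm]
      rw [if_neg hnS, ← Finset.add_sum_erase _ _ (Finset.mem_univ i), hsame i x y hxy hfi]
      have := Finset.card_nsmul_le_sum (Finset.univ.erase i) _ N fun j _ => hge j x y hxy
      rw [Finset.card_erase_of_mem (Finset.mem_univ i), Finset.card_univ, Fintype.card_fin,
        nsmul_eq_mul, Nat.add_sub_cancel] at this
      linarith
  have hmac : ∀ i s, cutWeight G w (A i s) ≤ mac G w := fun i s =>
    (isGreatest_mac G w).2 ⟨_, rfl⟩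
  have hSw : weight w S = ∑ e ∈ G.edgeSet.toFinite.toFinset, w e * if e ∈ S then 1 else 0 := by
    simp only [mul_ite, mul_one, mul_zero]
    rw [← Finset.sum_filter, weight]
    congr 1
    ext e
    simp only [Set.Finite.mem_toFinset, Finset.mem_filter]
    exact ⟨fun h => ⟨hS h, h⟩, fun h => h.2⟩
  refine le_of_mul_le_mul_left ?_ hNpos
  calc N * ((D + 2) * weight w G.edgeSet + D * weight w S)
      = ∑ e ∈ G.edgeSet.toFinite.toFinset,
          w e * (N * ((D + 2) + if e ∈ S then (D : ℝ) else 0)) := by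
        rw [hSw, weight, Finset.mul_sum, Finset.mul_sum, ← Finset.sum_add_distrib, Finset.mul_sum]
        refine Finset.sum_congr rfl fun e _ => ?_
        split_ifs <;> ring
    _ ≤ ∑ e ∈ G.edgeSet.toFinite.toFinset, w e *
          ∑ i, 2 * ∑ s, (if e ∈ (G.between (A i s) (A i s)ᶜ).edgeSet then (1 : ℝ) else 0) := by
        refine Finset.sum_le_sum fun e he => ?_
        rw [Set.Finite.mem_toFinset] at he
        exact mul_le_mul_of_nonneg_left (hedge e he) (hw e he)
    _ = ∑ i, ∑ s, 2 * cutWeight G w (A i s) := by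
        simp only [cutWeight_eq_sum, Finset.mul_sum]
        rw [Finset.sum_comm]
        refine Finset.sum_congr rfl fun i _ => ?_
        rw [Finset.sum_comm]
        refine Finset.sum_congr rfl fun s _ => Finset.sum_congr rfl fun e _ => ?_
        ring
    _ ≤ ∑ i : Fin (D + 1), ∑ s : Finset (Finset V) → Bool, 2 * mac G w :=
        Finset.sum_le_sum fun i _ => Finset.sum_le_sum fun s _ => by linarith [hmac i s]
    _ = N * (2 * (D + 1) * mac G w) := by
        simp only [Finset.sum_const, Finset.card_univ, Fintype.card_fin, nsmul_eq_mul, ← hN]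
        push_cast
        ring

/-- Contracting a matching in a graph of maximum degree at most `Δ ≥ 2` gives a graph of maximum
degree at most `2 * Δ - 2`. -/
theorem ncard_neighborSet_contraction_le [Fintype V] [DecidableEq V] (G : SimpleGraph V)
    [DecidableRel G.Adj] (Δ : ℕ) (h2 : 2 ≤ Δ) (hΔ : G.maxDegree ≤ Δ) (m : V → V)
    (hinv : Involutive m) (hm : ∀ x, m x ≠ x → G.Adj x (m x)) (P : Finset V) :
    ((contraction G fun x => ({x, m x} : Finset V)).neighborSet P).ncard ≤ 2 * Δ - 2 := by
  let q : V → Finset V := fun x => {x, m x}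
  have hqm : ∀ x, q (m x) = q x := fun x => by simp only [q, hinv x, Finset.pair_comm]
  have hdeg : ∀ x, (G.neighborFinset x).card ≤ Δ := fun x => (G.degree_le_maxDegree x).trans hΔ
  suffices h : ∃ T : Finset V, T.card ≤ 2 * Δ - 2 ∧
      (contraction G q).neighborSet P ⊆ q '' T by
    obtain ⟨T, hT, hsub⟩ := h
    calc _ ≤ (q '' T).ncard := Set.ncard_le_ncard hsub (Set.toFinite _)
      _ ≤ (T : Set V).ncard := Set.ncard_image_le (Set.toFinite _)
      _ ≤ _ := by rwa [Set.ncard_coe_finset]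
  by_cases hP : ∃ x, q x = P
  swap
  · exact ⟨∅, by simp, fun Q ⟨_, x, _, hx, _⟩ => absurd ⟨x, hx⟩ hP⟩
  obtain ⟨x, rfl⟩ := hP
  have hmem : ∀ z, q z = q x → z = x ∨ z = m x := by
    intro z hz
    have : z ∈ q x := hz ▸ by simp [q]
    simpa [q] using this
  by_cases hx : m x = x
  · refine ⟨G.neighborFinset x, (hdeg x).trans (by omega), ?_⟩
    rintro Q ⟨-, z, y, hz, rfl, hzy⟩
    have : z = x := by simpa [hx] using hmem z hz
    subst this
    exact ⟨y, by simpa using hzy, rfl⟩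
  · have hxm := hm x hx
    -- Each end of a contracted edge has at most `Δ - 1` neighbours besides the other end.
    refine ⟨(G.neighborFinset x).erase (m x) ∪ (G.neighborFinset (m x)).erase x, ?_, ?_⟩
    · refine (Finset.card_union_le _ _).trans ?_
      rw [Finset.card_erase_of_mem (by simpa using hxm),
        Finset.card_erase_of_mem (by simpa using hxm.symm)]
      have := hdeg x
      have := hdeg (m x)
      omega
    · rintro Q ⟨hne, z, y, hz, rfl, hzy⟩
      have h1 : y ≠ x := by rintro rfl; exact hne rfl
      have h2 : y ≠ m x := by rintro rfl; exact hne (hqm x).symm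
      refine ⟨y, ?_, rfl⟩
      rcases hmem z hz with rfl | rfl <;> simp [h1, h2, hzy]

end MaxCut

/-! ### The bound for a given matching -/

theorem mainTheorem4 {V : Type*} [Fintype V] (G : SimpleGraph V) [DecidableRel G.Adj]
    (w : Sym2 V → ℝ) (hw : ∀ e ∈ G.edgeSet, 0 ≤ w e)
    (hG : G.CliqueFree 3) (Δ : ℕ) (hΔ : G.maxDegree ≤ Δ)
    (M : G.Subgraph) (hM : M.IsMatching) :
    MaxCut.mac G w ≥
      (Δ : ℝ) / (2 * (Δ : ℝ) - 1) * (MaxCut.weight w G.edgeSet - MaxCut.weight w M.edgeSet)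
        + MaxCut.weight w M.edgeSet := by
  classical
  -- For `Δ ≤ 1` the edges of `G` themselves form a matching. Contracting all of them leaves no
  -- edges, and `D = 0` gives a cut of weight at least `w(G)`. For `Δ = 0` the denominator is `-1`,
  -- but every weight vanishes.
  rcases Nat.lt_or_ge Δ 2 with h2 | h2
  · have hu : ∀ x y z, G.Adj x y → G.Adj x z → y = z := by
      intro x y z hy hz
      have h1 : (G.neighborFinset x).card ≤ 1 :=
        ((G.degree_le_maxDegree x).trans hΔ).trans (by omega)
      exact Finset.card_le_one.1 h1 y (by simpa using hy) z (by simpa using hz)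
    obtain ⟨m, hinv, hm⟩ := MaxCut.exists_involution G.Adj (fun _ _ h => h.symm)
      (fun _ => G.irrefl) hu
    have hmac := MaxCut.mac_ge_of_contraction G w hw hG G.edgeSet subset_rfl m hinv hm 0 (by
      intro P
      rw [Nat.le_zero, Set.ncard_eq_zero, Set.eq_empty_iff_forall_notMem]
      rintro Q ⟨hne, x, y, rfl, rfl, hxy⟩
      have := ((hm x y).1 hxy).2
      subst this
      exact hne (by simp only [hinv x, Finset.pair_comm]))
    interval_cases Δ
    · have hE : G.edgeSet = ∅ := by
        rw [Set.eq_empty_iff_forall_notMem]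
        intro e
        induction e using Sym2.ind with
        | _ x y =>
        intro hxy
        have h1 : (G.neighborFinset x).card = 0 :=
          Nat.le_zero.1 ((G.degree_le_maxDegree x).trans hΔ)
        have : y ∈ G.neighborFinset x := by simpa using hxy
        rw [Finset.card_eq_zero.1 h1] at this
        simp at this
      have hME : M.edgeSet = ∅ := Set.subset_eq_empty M.edgeSet_subset hE
      rw [hE] at hmac
      rw [hE, hME]
      simp only [MaxCut.weight, Set.Finite.toFinset_empty, Finset.sum_empty] at *
      norm_num at hmac ⊢
      exact hmac
    · norm_num at hmac ⊢
      exact hmac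
  · obtain ⟨m, hinv, hm⟩ := MaxCut.exists_involution M.Adj (fun _ _ h => h.symm)
      (fun x h => G.irrefl h.adj_sub) (fun _ _ _ h h' => hM.eq_of_adj_left h h')
    have hmac := MaxCut.mac_ge_of_contraction G w hw hG M.edgeSet M.edgeSet_subset m hinv hm
      (2 * Δ - 2) (MaxCut.ncard_neighborSet_contraction_le G Δ h2 hΔ m hinv
        fun x hx => ((hm x (m x)).2 ⟨hx.symm, rfl⟩).adj_sub)
    -- With `D = 2Δ - 2`, `hmac` says `2Δ w(G) + (2Δ - 2) w(M) ≤ 2 (2Δ - 1) mac(G)`, which is the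
    -- claim cleared of its denominator.
    have hΔ' : (2 : ℝ) ≤ Δ := by exact_mod_cast h2
    rw [Nat.cast_sub (by omega)] at hmac
    push_cast at hmac
    have hpos : (0 : ℝ) < 2 * Δ - 1 := by linarith
    rw [ge_iff_le, div_mul_eq_mul_div, ← le_sub_iff_add_le, div_le_iff₀ hpos]
    linarith
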